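/- Let $F$ be an imaginary cyclic sextic field, i.e. a totally complex Galois extension of $\mathbb{Q}$ of degree $6$ whose Galois group is cyclic, regarded as a subfield of $\mathbb{C}$, and let $\tau$ be a generator of $\mathrm{Gal}(F/\mathbb{Q})$. Let $K$ be the maximal real subfield of $F$ (a cyclic cubic field) and let $p$ be its conductor, i.e. the least positive integer $n$ such that $K\subset\mathbb{Q}(\zeta_n)$, where $\zeta_n$ is a primitive $n$-th root of unity. Let $k=\mathbb{Q}(\sqrt{-d})$ be the imaginary quadratic subfield of $F$, where $d$ is a squarefree positive integer, and let $t=\gcd(p,d)$. Let $O_F,O_K,O_k$ be the rings of integers of $F,K,k$, and let $\mu_F$ be the set of roots of unity in $F$. For $f\in F$ put $$\|f\|^2=2\left(|f|^2+|\tau(f)|^2+|\tau^2(f)|^2\right).$$ **Proposition 3.2.** Assume that $d\equiv 1$ or $2 \pmod 4$, and let $\delta=\sqrt{-d}$. Let $\gamma,\beta\in O_K$ be such that $f=\frac{1}{t}(\gamma+\beta\delta)$ belongs to $O_F\setminus(O_K\cup O_k\cup\mu_F)$ and $\|f\|^2<22$. Then: 1. if $\beta\in O_K\setminus\mathbb{Z}$,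 then $p\le 19$ and $d\le 22$; 2. if $\beta\in\mathbb{Z}\setminus\{0\}$, then $p\le 61$ and $d\le 14$. -/

import Mathlib

open NumberField

/-- The ring of integers `O_L` of a subfield `L` of `F`, viewed inside `F`: the elements of `L`
that are integral over `ℤ`. For `L = F` (i.e. `⊤`) this is `O_F`. -/
def integersOf {F : Type*} [Field F] (L : Subfield F) : Subring F :=
  (integralClosure ℤ F).toSubring ⊓ L.toSubring

/-- The set `μ_F` of roots of unity of `F`. -/
def rootsOfUnitySet (F : Type*) [Field F] : Set F :=
  {x | ∃ n : ℕ, 0 < n ∧ x ^ n = 1}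

/-- `n` is the conductor of the (abelian) number field `K`: the least positive integer such
that `K` is contained in the `n`-th cyclotomic field `ℚ(ζ_n)`. -/
def IsConductor (K : Type*) [Field K] (n : ℕ) : Prop :=
  IsLeast {m : ℕ | 0 < m ∧ Nonempty (K →+* CyclotomicField m ℚ)} n

/-- The squared length `‖f‖² = 2 (|f|² + |τ f|² + |τ² f|²)`, where `F` is regarded as a subfield
of `ℂ` through `ι` and `τ` is an automorphism of `F`. -/
noncomputable def lengthSq {F : Type*} [Field F] [CharZero F] (ι : F →+* ℂ) (τ : Gal(F/ℚ))
    (f : F) : ℝ :=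
  2 * ∑ i ∈ Finset.range 3, ‖ι ((τ ^ i) f)‖ ^ 2

/-! Write `Tr` for the trace of `K/ℚ`, `G = Tr(γ²)`, `B = Tr(β²)`. Since `δ` is purely imaginary,
`‖f‖² = 2 (G + d B) / t²`, so the hypothesis reads `G + d B < 11 t²`. Two facts oppose it. Size: `3
Tr(x²) = Tr(x)² + 2 Q(x)`, where `Q` is `cyclicForm`. For `x ∉ ℤ` the integer `Q(x)` is positive,
and `p` divides it because the primes dividing `p` are totally ramified in `K`; hence `2p ≤ 3
Tr(x²)` (`two_mul_le_three_mul_trace_sq`). Divisibility: integrality of `f` makes each prime `q ∣ t`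
divide `β²`, and total ramification upgrades this to `t² ∣ B` (`sq_dvd_trace_sq`), or to `t ∣ β`
when `β ∈ ℤ`. So `d` is bounded by cancelling `t²`, and `p` by the size estimate for `β`, or for `γ`
when `β ∈ ℤ`; there `γ ∉ ℤ` because `f ∉ O_k`. Ramification is read off in `ℚ(ζ_n)` from an
automorphism supplied by minimality of the conductor. -/

/-! ### Trace and quadratic form modulo a totally ramified prime -/

section CyclicCubic

variable {A : Type*} [CommRing A]

/-- The trace `x + s x + s² x` with respect to an endomorphism `s`. -/
def cyclicTrace (s : A →+* A) (x : A) : A := x + s x + s (s x)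

/-- The quadratic form `x² + y² + z² - xy - yz - zx` at `y = s x`, `z = s² x`. -/
def cyclicForm (s : A →+* A) (x : A) : A :=
  x ^ 2 + s x ^ 2 + s (s x) ^ 2 - x * s x - s x * s (s x) - s (s x) * x

/-- `s` has order dividing three and its fixed points are the integers. -/
structure IsCyclicCubic (s : A →+* A) : Prop where
  cube : ∀ x, s (s (s x)) = x
  fixed : ∀ x, s x = x → ∃ n : ℤ, (n : A) = x

/-- `I` is an ideal lying over the prime `q` modulo which `s` acts trivially; over `3` its
elements moreover have squares divisible by `3`. -/
structure IsInertialIdeal (s : A →+* A) (q : ℕ) (I : Ideal A) : Prop where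
  sub_mem : ∀ x, s x - x ∈ I
  dvd : ∀ n : ℤ, (n : A) ∈ I → (q : ℤ) ∣ n
  self_mem : (q : A) ∈ I
  three : q = 3 → ∀ x ∈ I, (3 : A) ∣ x ^ 2

namespace IsCyclicCubic

variable {s : A →+* A} (hs : IsCyclicCubic s)
include hs

theorem exists_trace (x : A) : ∃ n : ℤ, (n : A) = cyclicTrace s x :=
  hs.fixed _ <| by simp only [cyclicTrace, map_add, hs.cube]; ring

theorem exists_form (x : A) : ∃ n : ℤ, (n : A) = cyclicForm s x :=
  hs.fixed _ <| by simp only [cyclicForm, map_add, map_sub, map_mul, map_pow, hs.cube]; ring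

theorem exists_norm (x : A) : ∃ n : ℤ, (n : A) = x * s x * s (s x) :=
  hs.fixed _ <| by simp only [map_mul, hs.cube]; ring

omit hs in
theorem three_mul_trace_sq (x : A) :
    3 * cyclicTrace s (x ^ 2) = cyclicTrace s x ^ 2 + 2 * cyclicForm s x := by
  simp only [cyclicTrace, cyclicForm, map_pow]; ring

end IsCyclicCubic

namespace IsInertialIdeal

variable {s : A →+* A} {q : ℕ} {I : Ideal A} (hI : IsInertialIdeal s q I)
include hI

theorem sub_mem' (x : A) : s (s x) - x ∈ I := by
  have := I.add_mem (hI.sub_mem (s x)) (hI.sub_mem x)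
  rwa [sub_add_sub_cancel] at this

theorem trace_sub_mem (x : A) : cyclicTrace s x - 3 * x ∈ I := by
  have := I.add_mem (hI.sub_mem x) (hI.sub_mem' x)
  convert this using 1
  simp only [cyclicTrace]; ring

theorem form_mem (x : A) : cyclicForm s x ∈ I := by
  have h : cyclicForm s x =
      (s x - x) * (s x - x) + (s (s x) - s x) * (s (s x) - x) := by
    simp only [cyclicForm]; ring
  rw [h]
  exact I.add_mem (I.mul_mem_left _ (hI.sub_mem x)) (I.mul_mem_left _ (hI.sub_mem' x))

theorem dvd_form {x : A} {n : ℤ} (hn : (n : A) = cyclicForm s x) : (q : ℤ) ∣ n :=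
  hI.dvd n (hn ▸ hI.form_mem x)

theorem nine_dvd_form [IsDomain A] [CharZero A] (hs : IsCyclicCubic s) (hq : q = 3) {x : A}
    {n : ℤ} (hn : (n : A) = cyclicForm s x) : (9 : ℤ) ∣ n := by
  obtain ⟨e, he⟩ := hI.three hq _ (hI.sub_mem x)
  obtain ⟨m, hm⟩ := hs.exists_trace e
  have h3 : (3 : A) ∈ I := by simpa [hq] using hI.self_mem
  have hmI : (m : A) ∈ I := by
    rw [hm, ← sub_add_cancel (cyclicTrace s e) (3 * e)]
    exact I.add_mem (hI.trace_sub_mem e) (I.mul_mem_right _ h3)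
  have hm3 : (3 : ℤ) ∣ m := by simpa [hq] using hI.dvd m hmI
  have h1 := congrArg s he
  have h2 := congrArg s h1
  simp only [map_pow, map_mul, map_sub, map_ofNat, hs.cube] at h1 h2
  -- Twice the form is the sum of the squares of the three conjugate differences, each a conjugate
  -- of `3 e`.
  have key : (2 * n : A) = 3 * m := by
    rw [hn, hm]
    simp only [cyclicForm, cyclicTrace]
    linear_combination he + h1 + h2
  have key' : 2 * n = 3 * m := by exact_mod_cast key
  omega

/-- With `x² = q e` it remains to see `q ∣ Tr e`. Norms give `N(x)² = q³ N(e)`, and the odd exponent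
forces `q ∣ N(e)`. Modulo `I` conjugates agree, so `e³ ≡ N(e) ≡ 0` and `(Tr e)³ ≡ 27 e³ ≡ 0`.
Working with cubes avoids needing `I` prime. -/
theorem sq_dvd_trace_sq [IsDomain A] [CharZero A] (hs : IsCyclicCubic s) (hq : q.Prime) {x : A}
    (hx : (q : A) ∣ x ^ 2) {n : ℤ} (hn : (n : A) = cyclicTrace s (x ^ 2)) :
    (q : ℤ) ^ 2 ∣ n := by
  obtain ⟨e, he⟩ := hx
  obtain ⟨m, hm⟩ := hs.exists_trace e
  obtain ⟨N, hN⟩ := hs.exists_norm x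
  obtain ⟨M, hM⟩ := hs.exists_norm e
  have hq' : Prime (q : ℤ) := Nat.prime_iff_prime_int.mp hq
  have h1 := congrArg s he
  have h2 := congrArg s h1
  simp only [map_pow, map_mul, map_natCast] at h1 h2
  have hNM : N ^ 2 = q ^ 3 * M := by
    have : (N : A) ^ 2 = q ^ 3 * M := by
      rw [hN, hM]
      calc (x * s x * s (s x)) ^ 2 = x ^ 2 * s x ^ 2 * s (s x) ^ 2 := by ring
        _ = _ := by rw [he, h1, h2]; ring
    exact_mod_cast this
  have hqM : (q : ℤ) ∣ M := by
    have hqN : (q : ℤ) ∣ N :=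
      hq'.dvd_of_dvd_pow ⟨q ^ 2 * M, by rw [hNM]; ring⟩
    obtain ⟨N', rfl⟩ := hqN
    have h3 : N' ^ 2 = q * M := by
      have : (q : ℤ) ^ 2 * N' ^ 2 = q ^ 2 * (q * M) := by linear_combination hNM
      exact mul_left_cancel₀ (pow_ne_zero 2 hq'.ne_zero) this
    obtain ⟨N'', rfl⟩ := hq'.dvd_of_dvd_pow (Dvd.intro _ h3.symm)
    refine ⟨N'' ^ 2, mul_left_cancel₀ hq'.ne_zero ?_⟩
    linear_combination -h3
  have hMI : (M : A) ∈ I := by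
    obtain ⟨c, rfl⟩ := hqM
    push_cast
    exact I.mul_mem_right _ hI.self_mem
  have he3 : e ^ 3 ∈ I := by
    have h : e ^ 3 = M - (e * s e * (s (s e) - e) + e ^ 2 * (s e - e)) := by rw [hM]; ring
    rw [h]
    exact I.sub_mem hMI
      (I.add_mem (I.mul_mem_left _ (hI.sub_mem' e)) (I.mul_mem_left _ (hI.sub_mem e)))
  have hm3 : ((m ^ 3 : ℤ) : A) ∈ I := by
    have h : ((m ^ 3 : ℤ) : A) =
        (m ^ 2 + m * (3 * e) + (3 * e) ^ 2) * (cyclicTrace s e - 3 * e) + 27 * e ^ 3 := by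
      rw [← hm]; push_cast; ring
    rw [h]
    exact I.add_mem (I.mul_mem_left _ (hI.trace_sub_mem e)) (I.mul_mem_left _ he3)
  obtain ⟨c, rfl⟩ := hq'.dvd_of_dvd_pow (hI.dvd _ hm3)
  refine ⟨c, ?_⟩
  have : (n : A) = q * (((q : ℤ) * c : ℤ) : A) := by
    rw [hn, hm, he]; simp only [cyclicTrace, map_mul, map_natCast]; ring
  have : n = q * (q * c) := by exact_mod_cast this
  rw [this]; ring

end IsInertialIdeal

end CyclicCubic

/-! ### Galois action on cyclotomic integers -/

section Cyclotomic

/-- The cofactor `1 + a + ⋯ + a^(q-1)` is a sum of `q` terms congruent to `1` modulo `q`. -/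
theorem Int.mul_dvd_pow_sub_one {a m : ℤ} {q : ℕ} (h : m ∣ a - 1) (hq : (q : ℤ) ∣ m) :
    q * m ∣ a ^ q - 1 := by
  rw [← mul_geom_sum, mul_comm (q : ℤ)]
  refine mul_dvd_mul h ?_
  have h1 : a ≡ 1 [ZMOD q] := ((Int.modEq_iff_dvd.mpr (hq.trans h))).symm
  have h2 : ∑ i ∈ Finset.range q, a ^ i ≡ 0 [ZMOD q] := by
    rw [← ZMod.intCast_eq_intCast_iff] at h1 ⊢
    push_cast at h1 ⊢
    simp [h1]
  exact Int.modEq_zero_iff_dvd.mp h2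

variable {n : ℕ} [NeZero n] {L : Type*} [Field L] [NumberField L] [IsCyclotomicExtension {n} ℚ L]
  {ζ : L} (hζ : IsPrimitiveRoot ζ n)
include hζ

namespace IsPrimitiveRoot

theorem galois_ext {σ τ : Gal(L/ℚ)} (h : σ ζ = τ ζ) : σ = τ := by
  apply hζ.autToPow_injective ℚ
  have h1 := hζ.autToPow_spec ℚ σ
  rw [h, ← hζ.autToPow_spec ℚ τ] at h1
  exact Units.ext (ZMod.val_injective n
    (hζ.pow_inj (ZMod.val_lt _) (ZMod.val_lt _) h1))

theorem exists_galois_apply {b : ℕ} (hb : b.Coprime n) : ∃ σ : Gal(L/ℚ), σ ζ = ζ ^ b := by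
  obtain ⟨σ, hσ⟩ := (IsCyclotomicExtension.autEquivPow L
    (Polynomial.cyclotomic.irreducible_rat (NeZero.pos n))).surjective (ZMod.unitOfCoprime b hb)
  refine ⟨σ, ?_⟩
  have hz := IsCyclotomicExtension.zeta_spec n ℚ L
  have h1 := hz.autToPow_spec ℚ σ
  have h2 : hz.autToPow ℚ σ = ZMod.unitOfCoprime b hb := hσ
  rw [h2, ZMod.coe_unitOfCoprime, ZMod.val_natCast] at h1
  obtain ⟨i, -, hi⟩ := hz.eq_pow_of_pow_eq_one hζ.pow_eq_one
  rw [← hi, map_pow, ← h1, ← pow_mul, ← pow_mul, mul_comm i]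
  exact ((hz.isOfFinOrder (NeZero.ne n)).pow_eq_pow_iff_modEq).mpr
    (by rw [← hz.eq_orderOf]; exact (Nat.mod_modEq b n).mul_right i)

omit [NumberField L] [IsCyclotomicExtension {n} ℚ L] in
theorem pow_eq_pow_iff_dvd {a b : ℕ} : ζ ^ a = ζ ^ b ↔ (n : ℤ) ∣ a - b := by
  rw [(hζ.isOfFinOrder (NeZero.ne n)).pow_eq_pow_iff_modEq, ← hζ.eq_orderOf]
  exact Nat.ModEq.comm.trans Nat.modEq_iff_dvd

omit [NeZero n] [IsCyclotomicExtension {n} ℚ L] hζ in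
theorem _root_.galois_pow_apply {σ : Gal(L/ℚ)} {a : ℕ} (h : σ ζ = ζ ^ a) (j : ℕ) :
    (σ ^ j) ζ = ζ ^ a ^ j := by
  induction j with
  | zero => simp
  | succ j ih => rw [pow_succ, AlgEquiv.mul_apply, h, map_pow, ih, ← pow_mul, ← pow_succ]

theorem galois_pow_eq_one {σ : Gal(L/ℚ)} {a : ℕ} (h : σ ζ = ζ ^ a) {j : ℕ}
    (hj : (n : ℤ) ∣ (a : ℤ) ^ j - 1) : σ ^ j = 1 := by
  apply hζ.galois_ext
  rw [galois_pow_apply h, AlgEquiv.one_apply, ← pow_one ζ, ← pow_mul, one_mul,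
    hζ.pow_eq_pow_iff_dvd]
  push_cast
  exact hj

/-- An automorphism with `ζ ↦ ζ ^ (1 + m x)` is trivial modulo `ζ ^ m - 1`. -/
theorem dvd_galois_sub {σ : Gal(L/ℚ)} {m x : ℕ} (h : σ ζ = ζ ^ (1 + m * x)) (y : 𝓞 L) :
    hζ.toInteger ^ m - 1 ∣ RingOfIntegers.mapRingHom (σ : L →+* L) y - y := by
  -- As `𝓞 L = ℤ[ζ]`, the claim reduces to the generator `ζ`.
  have hy : y ∈ Algebra.adjoin ℤ {hζ.toInteger} := by
    rw [IsCyclotomicExtension.Rat.adjoin_singleton_eq_top hζ]; trivial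
  induction hy using Algebra.adjoin_induction with
  | mem y hy =>
    obtain rfl := hy
    have : RingOfIntegers.mapRingHom (σ : L →+* L) hζ.toInteger =
        hζ.toInteger ^ (1 + m * x) := by
      apply RingOfIntegers.ext
      rw [RingOfIntegers.mapRingHom_apply]
      exact h.trans (map_pow (algebraMap (𝓞 L) L) hζ.toInteger (1 + m * x)).symm
    rw [this]
    have h2 : hζ.toInteger ^ (1 + m * x) - hζ.toInteger =
        hζ.toInteger * ((hζ.toInteger ^ m) ^ x - 1) := by ring
    rw [h2]
    exact (sub_one_dvd_pow_sub_one _ x).mul_left _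
  | algebraMap r => simp
  | add u v _ _ hu hv =>
    rw [map_add, add_sub_add_comm]
    exact dvd_add hu hv
  | mul u v _ _ hu hv =>
    rw [map_mul]
    have : RingOfIntegers.mapRingHom (σ : L →+* L) u * RingOfIntegers.mapRingHom (σ : L →+* L) v
        - u * v = RingOfIntegers.mapRingHom (σ : L →+* L) u *
        (RingOfIntegers.mapRingHom (σ : L →+* L) v - v) +
        (RingOfIntegers.mapRingHom (σ : L →+* L) u - u) * v := by ring
    rw [this]
    exact dvd_add (hv.mul_left _) (hu.mul_right _)

end IsPrimitiveRoot

end Cyclotomic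

/-! ### The element `ξ - 1` above a prime `q` -/

section PrimitivePrimeRoot

variable {L : Type*} [Field L] [NumberField L]

theorem NumberField.RingOfIntegers.natCast_dvd_intCast {q : ℕ} {N : ℤ}
    (h : (q : 𝓞 L) ∣ (N : 𝓞 L)) : (q : ℤ) ∣ N := by
  have := map_dvd (Algebra.norm ℤ) h
  have h1 : (q : 𝓞 L) = algebraMap ℤ (𝓞 L) q := by simp
  have h2 : (N : 𝓞 L) = algebraMap ℤ (𝓞 L) N := by simp
  rw [h1, h2, Algebra.norm_algebraMap, Algebra.norm_algebraMap] at this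
  exact (Int.pow_dvd_pow_iff Module.finrank_pos.ne').mp this

namespace IsPrimitiveRoot

variable {q : ℕ} {ξ : 𝓞 L} (hξ : IsPrimitiveRoot ξ q) (hq : q.Prime)
include hξ hq

/-- `q` is the product of the `q - 1` factors `1 - ξ^i`, all associated to `ξ - 1`, so `q ∣
N^(q-1)`. -/
theorem dvd_of_sub_one_dvd {N : ℤ} (h : ξ - 1 ∣ (N : 𝓞 L)) : (q : ℤ) ∣ N := by
  obtain ⟨k, rfl⟩ := Nat.exists_eq_succ_of_ne_zero hq.ne_zero
  have hp := hξ.prod_one_sub_pow_eq_order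
  have hd : ∏ i ∈ Finset.range k, (1 - ξ ^ (i + 1)) ∣ ∏ _i ∈ Finset.range k, (N : 𝓞 L) := by
    refine Finset.prod_dvd_prod_of_dvd _ _ fun i hi => ?_
    have hc : (i + 1).Coprime (k + 1) :=
      
      (Nat.coprime_of_lt_prime i.succ_ne_zero (by simpa using Finset.mem_range.mp hi) hq).symm
    rw [← neg_sub, neg_dvd]
    exact (hξ.associated_sub_one_pow_sub_one_of_coprime hc).symm.dvd.trans h
  rw [hp, Finset.prod_const, Finset.card_range] at hd
  have : ((k + 1 : ℕ) : 𝓞 L) ∣ ((N ^ k : ℤ) : 𝓞 L) := by exact_mod_cast hd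
  exact (Nat.prime_iff_prime_int.mp hq).dvd_of_dvd_pow
    (RingOfIntegers.natCast_dvd_intCast this)

omit [NumberField L] hq in
theorem three_dvd_sub_one_sq (h3 : q = 3) : (3 : 𝓞 L) ∣ (ξ - 1) ^ 2 := by
  subst h3
  have h := hξ.geom_sum_eq_zero (by norm_num)
  simp only [Finset.sum_range_succ, Finset.sum_range_zero] at h
  exact ⟨-ξ, by linear_combination h⟩

end IsPrimitiveRoot

end PrimitivePrimeRoot

/-! ### Ramification at primes dividing the conductor -/

section Conductor

/-- `CyclotomicField n ℚ` is cyclotomic for the `ℚ`-algebra structure of a field of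
characteristic zero. -/
instance CyclotomicField.isCyclotomicExtension_toRatAlgebra (n : ℕ) [NeZero n] :
    IsCyclotomicExtension {n} ℚ (CyclotomicField n ℚ) := by
  have h := CyclotomicField.isCyclotomicExtension n ℚ
  have e : CyclotomicField.algebra n ℚ = DivisionRing.toRatAlgebra := Subsingleton.elim _ _
  rwa [e] at h

variable {K : Type*} [Field K] [NumberField K]

theorem NumberField.RingOfIntegers.natCast_dvd_of_map {L : Type*} [Field L] [NumberField L]
    [Algebra K L] {a : ℕ} {x : 𝓞 K} (ha : a ≠ 0)
    (h : (a : 𝓞 L) ∣ algebraMap (𝓞 K) (𝓞 L) x) : (a : 𝓞 K) ∣ x := by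
  obtain ⟨y, hy⟩ := h
  have hy' : algebraMap K L x = a * (y : L) := by
    have := congrArg (algebraMap (𝓞 L) L) hy
    simpa [← IsScalarTower.algebraMap_apply (𝓞 K) (𝓞 L) L,
      IsScalarTower.algebraMap_apply (𝓞 K) K L] using this
  have ha' : (a : K) ≠ 0 := by exact_mod_cast ha
  have ha'' : (a : L) ≠ 0 := by exact_mod_cast ha
  have hint : IsIntegral ℤ ((x : K) / a) := by
    rw [← isIntegral_algebraMap_iff (algebraMap K L).injective, map_div₀, hy', map_natCast,
      mul_div_cancel_left₀ _ ha'']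
    exact y.2
  refine ⟨⟨_, hint⟩, RingOfIntegers.ext ?_⟩
  change (x : K) = algebraMap (𝓞 K) K (a : 𝓞 K) * ((x : K) / a)
  rw [map_natCast, mul_div_cancel₀ _ ha']

variable {n q : ℕ}

-- Otherwise `K` would be fixed by every automorphism fixing `ζ^q`, hence lie in `ℚ(ζ_{n/q})`,
-- against minimality of `n`.
omit [NumberField K] in
theorem IsConductor.exists_galois_ne_one (hn : IsConductor K n) (hq : q.Prime) (hqn : q ∣ n)
    [Algebra K (CyclotomicField n ℚ)] {ζ : CyclotomicField n ℚ} (hζ : IsPrimitiveRoot ζ n) :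
    ∃ σ : Gal(CyclotomicField n ℚ/ℚ), σ (ζ ^ q) = ζ ^ q ∧
      ∃ x : K, σ (algebraMap K _ x) ≠ algebraMap K _ x := by
  by_contra! H
  obtain ⟨m, rfl⟩ := hqn
  have hpos : 0 < q * m := hn.1.1
  have hm : 0 < m := Nat.pos_of_mul_pos_left hpos
  have : NeZero (q * m) := ⟨hpos.ne'⟩
  have : NeZero m := ⟨hm.ne'⟩
  have : IsGalois ℚ (CyclotomicField (q * m) ℚ) := IsCyclotomicExtension.isGalois {q * m} ℚ _
  have hζq : IsPrimitiveRoot (ζ ^ q) m := hζ.pow hpos rfl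
  let E := IntermediateField.adjoin ℚ {ζ ^ q}
  have hE : IsCyclotomicExtension {m} ℚ E := hζq.intermediateField_adjoin_isCyclotomicExtension ℚ
  have hmem : ∀ x : K, algebraMap K (CyclotomicField (q * m) ℚ) x ∈ E.toSubfield := by
    intro x
    have : algebraMap K _ x ∈ IntermediateField.fixedField E.fixingSubgroup := by
      rw [IntermediateField.mem_fixedField_iff]
      intro σ hσ
      exact H σ (hσ ⟨ζ ^ q, IntermediateField.mem_adjoin_simple_self ℚ _⟩) x
    rwa [IsGalois.fixedField_fixingSubgroup] at this
  have hle := hn.2 ⟨hm, ⟨((IsCyclotomicExtension.algEquiv {m} ℚ E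
    (CyclotomicField m ℚ) : E →+* _).comp
      ((algebraMap K (CyclotomicField (q * m) ℚ)).codRestrict E.toSubfield hmem))⟩⟩
  have := hq.two_le
  nlinarith

/-- The conditions satisfied by a prime `q` dividing the conductor `n` of a cyclic cubic field:
`q ≡ 1 mod 3` with exponent one, or `q = 3` with exponent at most two. -/
structure IsConductorPrime (n q : ℕ) : Prop where
  three : q = 3 → ¬ 27 ∣ n
  ne_three : q ≠ 3 → q % 3 = 1 ∧ ¬ q ^ 2 ∣ n

/-- The image of `σ` has order 3, so `σ ^ j = 1` forces `3 ∣ j`. If `q ∣ m` then `σ ^ q = 1`, so `q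
= 3`; if not, Fermat gives `σ ^ (q - 1) = 1`, so `q ≡ 1 mod 3`. -/
theorem isConductorPrime_of_galois {G : Type*} [Group G] (hG : Nat.card G = 3) [NeZero n]
    {L : Type*} [Field L] [NumberField L] [IsCyclotomicExtension {n} ℚ L] {ζ : L}
    (hζ : IsPrimitiveRoot ζ n) (ρ : Gal(L/ℚ) →* G) {σ : Gal(L/ℚ)} (hσ : ρ σ ≠ 1) {m x : ℕ}
    (hn : n = q * m) (hq : q.Prime) (hσζ : σ ζ = ζ ^ (1 + m * x)) : IsConductorPrime n q := by
  have h3 : ∀ g : G, g ^ 3 = 1 := fun g => hG ▸ pow_card_eq_one'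
  have hdiv : ∀ j : ℕ, σ ^ j = 1 → 3 ∣ j := by
    intro j hj
    have h1 : (ρ σ) ^ j = 1 := by rw [← map_pow, hj, map_one]
    have h2 : orderOf (ρ σ) = 3 := orderOf_eq_prime (h3 _) hσ
    exact h2 ▸ orderOf_dvd_of_pow_eq_one h1
  have hm1 : (m : ℤ) ∣ ((1 + m * x : ℕ) : ℤ) - 1 := ⟨x, by push_cast; ring⟩
  have hqm : q ∣ m → q = 3 := fun h => by
    have h1 := hdiv q (hζ.galois_pow_eq_one hσζ (by
      rw [hn]; push_cast
      exact_mod_cast Int.mul_dvd_pow_sub_one hm1 (Int.natCast_dvd_natCast.mpr h)))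
    exact ((Nat.prime_dvd_prime_iff_eq Nat.prime_three hq).mp h1).symm
  refine ⟨fun hq3 h27 => ?_, fun hq3 => ?_⟩
  · subst hq3
    obtain ⟨r, hr⟩ : 9 ∣ m := by omega
    -- Here `n = 27 r`, and `(1 + 3 r x)³ ≡ 1 + 9 r x` modulo `n`: thus `σ` is a cube and dies in a
    -- group of order 3.
    have hb : (1 + 3 * r * x).Coprime n := by
      have h1 : (1 + 3 * r * x).Coprime (3 * r) := by simp
      have h2 : n ∣ (3 * r) ^ 3 := ⟨r ^ 2, by rw [hn, hr]; ring⟩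
      exact (h1.pow_right 3).coprime_dvd_right h2
    obtain ⟨σ', hσ'⟩ := hζ.exists_galois_apply hb
    apply hσ
    have : σ = σ' ^ 3 := by
      apply hζ.galois_ext
      rw [hσζ, galois_pow_apply hσ', hζ.pow_eq_pow_iff_dvd, hn, hr]
      exact ⟨-(r * x ^ 2 + r ^ 2 * x ^ 3), by push_cast; ring⟩
    rw [this, map_pow, h3]
  · have hqm' : ¬ q ∣ m := fun h => hq3 (hqm h)
    refine ⟨?_, fun ⟨r, hr⟩ => hqm' ⟨r, mul_left_cancel₀ hq.ne_zero (by rw [← hn, hr]; ring)⟩⟩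
    have hcop : IsCoprime (q : ℤ) m :=
      Nat.isCoprime_iff_coprime.mpr ((hq.coprime_iff_not_dvd).mpr hqm')
    have := Fact.mk hq
    have hne : ((1 + m * x : ℕ) : ZMod q) ≠ 0 := by
      intro h0
      rw [ZMod.natCast_eq_zero_iff] at h0
      have hu := (hζ.map_of_injective (f := (σ : L →+* L)) σ.injective)
      have hu' : IsPrimitiveRoot (ζ ^ (1 + m * x)) n := hσζ ▸ hu
      have hc := (hζ.pow_iff_coprime (NeZero.pos n) _).mp hu'
      exact hq.one_lt.ne' (Nat.dvd_one.mp (hc ▸ Nat.dvd_gcd h0 (hn ▸ dvd_mul_right q m)))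
    have h1 : (q : ℤ) ∣ ((1 + m * x : ℕ) : ℤ) ^ (q - 1) - 1 := by
      rw [← ZMod.intCast_zmod_eq_zero_iff_dvd]
      push_cast
      have := ZMod.pow_card_sub_one_eq_one hne
      push_cast at this
      rw [this, sub_self]
    have h2 : (m : ℤ) ∣ ((1 + m * x : ℕ) : ℤ) ^ (q - 1) - 1 :=
      hm1.trans (sub_one_dvd_pow_sub_one _ _)
    have h4 := hdiv (q - 1) (hζ.galois_pow_eq_one hσζ (by
      rw [hn, Nat.cast_mul]; exact hcop.mul_dvd h1 h2))
    have := hq.two_le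
    omega

/-- A prime dividing the conductor of a cyclic cubic field is totally ramified. -/
theorem IsConductor.exists_inertialIdeal [IsGalois ℚ K] (hK : Module.finrank ℚ K = 3)
    (hn : IsConductor K n) (hq : q.Prime) (hqn : q ∣ n) (s : Gal(K/ℚ)) :
    IsConductorPrime n q ∧
      ∃ I : Ideal (𝓞 K), IsInertialIdeal (RingOfIntegers.mapRingHom (s : K →+* K)) q I := by
  have hpos : 0 < n := hn.1.1
  have : NeZero n := ⟨hpos.ne'⟩
  obtain ⟨φ⟩ := hn.1.2
  let _ : Algebra K (CyclotomicField n ℚ) := φ.toAlgebra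
  have hG : Nat.card Gal(K/ℚ) = 3 := by rw [IsGalois.card_aut_eq_finrank, hK]
  set ζ := IsCyclotomicExtension.zeta n ℚ (CyclotomicField n ℚ)
  have hζ : IsPrimitiveRoot ζ n := IsCyclotomicExtension.zeta_spec n ℚ _
  obtain ⟨σ, hσq, x, hx⟩ := hn.exists_galois_ne_one hq hqn hζ
  let ρ : Gal(CyclotomicField n ℚ/ℚ) →* Gal(K/ℚ) := AlgEquiv.restrictNormalHom K
  have hρ : ∀ (θ : Gal(CyclotomicField n ℚ/ℚ)) (y : K),
      algebraMap K (CyclotomicField n ℚ) (ρ θ y) = θ (algebraMap K _ y) :=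
    fun θ y => AlgEquiv.restrictNormal_commutes θ K y
  have hσ : ρ σ ≠ 1 := fun h => hx (by rw [← hρ, h, AlgEquiv.one_apply])
  obtain ⟨m, hm⟩ := hqn
  have hm0 : 0 < m := Nat.pos_of_mul_pos_left (hm ▸ hpos)
  obtain ⟨e, he⟩ : ∃ e : ℕ, σ ζ = ζ ^ (1 + m * e) := by
    obtain ⟨a, -, ha⟩ := hζ.eq_pow_of_pow_eq_one
      (ξ := σ ζ) (by rw [← map_pow, hζ.pow_eq_one, map_one])
    rw [map_pow, ← ha, ← pow_mul, hζ.pow_eq_pow_iff_dvd, hm] at hσq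
    push_cast at hσq
    have h1 : (m : ℤ) ∣ a - 1 := by
      have hq0 : (q : ℤ) ≠ 0 := by exact_mod_cast hq.ne_zero
      refine (mul_dvd_mul_iff_left hq0).mp (hσq.trans (dvd_of_eq (by ring)))
    obtain ⟨c, hc⟩ := h1
    -- Only `c` modulo `q` matters, so it may be taken nonnegative.
    obtain ⟨c', hc'⟩ : ∃ c' : ℕ, (n : ℤ) ∣ a - (1 + m * c' : ℕ) := by
      refine ⟨(c % q).toNat, ?_⟩
      have hq0 : (q : ℤ) ≠ 0 := by exact_mod_cast hq.ne_zero
      have h2 := Int.emod_nonneg c hq0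
      have h3 := Int.mul_ediv_add_emod c q
      push_cast
      rw [Int.toNat_of_nonneg h2, hm]
      refine ⟨c / q, ?_⟩
      push_cast
      linear_combination hc - m * h3
    exact ⟨c', by rw [← ha, hζ.pow_eq_pow_iff_dvd]; exact hc'⟩
  refine ⟨isConductorPrime_of_galois hG hζ ρ hσ hm hq he, ?_⟩
  set π : 𝓞 (CyclotomicField n ℚ) := hζ.toInteger ^ m - 1
  have hξ : IsPrimitiveRoot (hζ.toInteger ^ m) q :=
    hζ.toInteger_isPrimitiveRoot.pow hpos (by rw [hm, mul_comm])
  -- `σ` is trivial modulo `π`, so its restriction to `K`, which generates `Gal(K/ℚ)`, is trivial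
  -- modulo the contraction of `(π)`.
  let I : Ideal (𝓞 K) := (Ideal.span {π}).comap (algebraMap (𝓞 K) (𝓞 (CyclotomicField n ℚ)))
  have hI : ∀ y, y ∈ I ↔ π ∣ algebraMap (𝓞 K) (𝓞 (CyclotomicField n ℚ)) y := fun y => by
    rw [Ideal.mem_comap, Ideal.mem_span_singleton]
  have hsub : ∀ y, RingOfIntegers.mapRingHom (ρ σ : K →+* K) y - y ∈ I := by
    intro y
    rw [hI, map_sub]
    have h := hζ.dvd_galois_sub he (algebraMap (𝓞 K) (𝓞 (CyclotomicField n ℚ)) y)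
    convert h using 2
    apply RingOfIntegers.ext
    exact hρ σ y
  refine ⟨I, ?_, fun N hN => ?_, ?_, fun h3 y hy => ?_⟩
  · have := Fact.mk Nat.prime_three
    obtain ⟨k, hk⟩ := mem_powers_of_prime_card (g := ρ σ) (g' := s) hG hσ
    dsimp only at hk
    have hmem : ∀ k : ℕ, ∀ y, RingOfIntegers.mapRingHom ((ρ σ ^ k : Gal(K/ℚ)) : K →+* K) y - y
        ∈ I := by
      intro k
      induction k with
      | zero => intro y; convert I.zero_mem; rw [sub_eq_zero]; rfl
      | succ k ih =>
        intro y
        convert I.add_mem (hsub (RingOfIntegers.mapRingHom ((ρ σ ^ k : Gal(K/ℚ)) : K →+* K) y))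
          (ih y) using 1
        rw [sub_add_sub_cancel, pow_succ']
        rfl
    exact hk ▸ hmem k
  · rw [hI, map_intCast] at hN
    exact hξ.dvd_of_sub_one_dvd hq hN
  · rw [hI, map_natCast]
    exact hξ.sub_one_dvd_natCast hq.one_lt
  · rw [hI] at hy
    have h := (hξ.three_dvd_sub_one_sq h3).trans (pow_dvd_pow_of_dvd hy 2)
    rw [← map_pow] at h
    exact_mod_cast RingOfIntegers.natCast_dvd_of_map (a := 3) (by norm_num) (by exact_mod_cast h)

end Conductor

/-! ### Numerical bounds -/

section Bounds

variable {A : Type*} [CommRing A] {s : A →+* A}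

namespace IsCyclicCubic

theorem trace_sq_nonneg (ψ : A →+* ℝ) {x : A} {n : ℤ} (hn : (n : A) = cyclicTrace s (x ^ 2)) :
    0 ≤ n := by
  have h := congrArg ψ hn
  simp only [cyclicTrace, map_add, map_pow, map_intCast] at h
  have : (0 : ℝ) ≤ n := by rw [h]; positivity
  exact_mod_cast this

theorem trace_sq_pos {ψ : A →+* ℝ} (hψ : Function.Injective ψ) {x : A} (hx : x ≠ 0) {n : ℤ}
    (hn : (n : A) = cyclicTrace s (x ^ 2)) : 0 < n := by
  have h := congrArg ψ hn
  simp only [cyclicTrace, map_add, map_pow, map_intCast] at h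
  have hx' : ψ x ≠ 0 := (map_ne_zero_iff ψ hψ).mpr hx
  have : (0 : ℝ) < n := by rw [h]; positivity
  exact_mod_cast this

/-- In `ℝ` the form is half the sum of the squared conjugate differences, and `s x = x` only for
integers. -/
theorem form_pos (hs : IsCyclicCubic s) {ψ : A →+* ℝ} (hψ : Function.Injective ψ) {x : A}
    (hx : ∀ m : ℤ, (m : A) ≠ x) {n : ℤ} (hn : (n : A) = cyclicForm s x) : 0 < n := by
  have h := congrArg ψ hn
  simp only [cyclicForm, map_add, map_sub, map_mul, map_pow, map_intCast] at h
  have hne : ψ x - ψ (s x) ≠ 0 := fun h0 => by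
    obtain ⟨m, hm⟩ := hs.fixed x (hψ (sub_eq_zero.mp h0).symm)
    exact hx m hm
  have hpos := pow_pos (abs_pos.mpr hne) 2
  rw [sq_abs] at hpos
  have : (0 : ℝ) < n := by
    nlinarith [sq_nonneg (ψ (s x) - ψ (s (s x))), sq_nonneg (ψ (s (s x)) - ψ x)]
  exact_mod_cast this

/-- The trace of `x²` is at least `2 p / 3` when `p` divides the values of `cyclicForm`. -/
theorem two_mul_le_three_mul_trace_sq [CharZero A] (hs : IsCyclicCubic s) {ψ : A →+* ℝ}
    (hψ : Function.Injective ψ) {p : ℕ}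
    (hp : ∀ (x : A) (n : ℤ), (n : A) = cyclicForm s x → (p : ℤ) ∣ n) {x : A}
    (hx : ∀ m : ℤ, (m : A) ≠ x) {n : ℤ} (hn : (n : A) = cyclicTrace s (x ^ 2)) :
    2 * (p : ℤ) ≤ 3 * n := by
  obtain ⟨a, ha⟩ := hs.exists_trace x
  obtain ⟨r, hr⟩ := hs.exists_form x
  have h1 := three_mul_trace_sq (s := s) x
  rw [← hn, ← ha, ← hr] at h1
  have h2 : 3 * n = a ^ 2 + 2 * r := by exact_mod_cast h1
  have h3 := Int.le_of_dvd (hs.form_pos hψ hx hr) (hp x r hr)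
  nlinarith [sq_nonneg a]

end IsCyclicCubic

theorem natCast_dvd_of_squarefree_dvd {t : ℕ} (ht : Squarefree t) {k : ℕ} {b : ℤ}
    (h : ∀ q : ℕ, q.Prime → q ∣ t → (q : ℤ) ^ k ∣ b) : (t : ℤ) ^ k ∣ b := by
  rw [← Nat.prod_primeFactors_of_squarefree ht, Nat.cast_prod, ← Finset.prod_pow]
  refine Finset.prod_dvd_of_coprime (fun q hq r hr hqr => ?_) fun q hq =>
    h q (Nat.prime_of_mem_primeFactors hq) (Nat.dvd_of_mem_primeFactors hq)
  exact (Nat.isCoprime_iff_coprime.mpr ((Nat.coprime_primes (Nat.prime_of_mem_primeFactors hq)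
    (Nat.prime_of_mem_primeFactors hr)).mpr hqr)).pow

/-- The stated bounds have slack: the argument yields `p ≤ 15` in both cases, with `d ≤ 10` in the
first and `d ≤ 2` in the second. -/
theorem conductor_discriminant_bounds [IsDomain A] [CharZero A] (hs : IsCyclicCubic s)
    {ψ : A →+* ℝ} (hψ : Function.Injective ψ) {p : ℕ}
    (hp : ∀ (x : A) (n : ℤ), (n : A) = cyclicForm s x → (p : ℤ) ∣ n)
    (hram : ∀ q : ℕ, q.Prime → q ∣ p → IsConductorPrime p q ∧ ∃ I, IsInertialIdeal s q I)
    {d : ℕ} (hd : Squarefree d) (hd4 : d % 4 = 1 ∨ d % 4 = 2) {t : ℕ} (ht : t = p.gcd d)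
    {γ β : A} (hβ : (t : A) ∣ 4 * (d / t : ℕ) * β ^ 2) {G B : ℤ}
    (hG : (G : A) = cyclicTrace s (γ ^ 2)) (hB : (B : A) = cyclicTrace s (β ^ 2))
    (hlt : G + d * B < 11 * t ^ 2) :
    ((∀ b : ℤ, (b : A) ≠ β) → p ≤ 19 ∧ d ≤ 22) ∧
    (∀ b : ℤ, (b : A) = β → b ≠ 0 → (∀ c : ℤ, (c : A) ≠ γ) → p ≤ 61 ∧ d ≤ 14) := by
  have htp : t ∣ p := ht ▸ Nat.gcd_dvd_left p d
  have htd : t ∣ d := ht ▸ Nat.gcd_dvd_right p d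
  have htsq : Squarefree t := hd.squarefree_of_dvd htd
  have ht0 : 0 < t := Nat.pos_of_ne_zero htsq.ne_zero
  have hprime : ∀ q : ℕ, q.Prime → q ∣ t → q = 3 ∨ q % 3 = 1 := fun q hq hqt => by
    by_cases h3 : q = 3
    · exact Or.inl h3
    · exact Or.inr ((hram q hq (hqt.trans htp)).1.ne_three h3).1
  -- `h2`, `h9` and `h5` prune the final enumeration over `d < 11`: only `t = 1`, or `t = 3` with `d
  -- = 6`, survives.
  have h2 : ¬ 2 ∣ t := fun h => by have := hprime 2 Nat.prime_two h; omega
  have h9 : d ≠ 9 := fun h => by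
    have := hd 3 (h ▸ by norm_num)
    norm_num at this
  have h5 : ¬ 5 ∣ t := fun h => by have := hprime 5 Nat.prime_five h; omega
  have hqβ : ∀ q : ℕ, q.Prime → q ∣ t → (q : A) ∣ β ^ 2 := by
    intro q hq hqt
    have hq2 : q ≠ 2 := fun h => h2 (h ▸ hqt)
    have hqd : ¬ q ∣ d / t := fun h => by
      have h1 : q * q ∣ t * (d / t) := mul_dvd_mul hqt h
      rw [Nat.mul_div_cancel' htd] at h1
      exact hq.one_lt.ne' (Nat.isUnit_iff.mp (hd q h1))
    have hc : q.Coprime (4 * (d / t)) :=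
      Nat.Coprime.mul_right
        (((Nat.coprime_primes hq Nat.prime_two).mpr hq2).pow_right 2)
        (hq.coprime_iff_not_dvd.mpr hqd)
    -- A Bézout relation cancels the factor `4 (d / t)`, prime to `q`.
    obtain ⟨u, v, huv⟩ := Nat.isCoprime_iff_coprime.mpr hc
    have hcast : ∀ e : ℕ, u * q + v * (4 * e : ℕ) = 1 → (u : A) * q + v * (4 * e) = 1 :=
      fun e he => by simpa using congrArg (Int.cast (R := A)) he
    have huv' := hcast _ huv
    have h1 : (q : A) ∣ 4 * (d / t : ℕ) * β ^ 2 := (Nat.cast_dvd_cast hqt).trans hβ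
    have h3 : β ^ 2 = u * β ^ 2 * q + v * (4 * (d / t : ℕ) * β ^ 2) := by
      linear_combination (-β ^ 2) * huv'
    rw [h3]
    exact dvd_add (dvd_mul_left _ _) (h1.mul_left _)
  have hG0 : 0 ≤ G := IsCyclicCubic.trace_sq_nonneg ψ hG
  have ht0' : (0 : ℤ) < (t : ℤ) ^ 2 := by positivity
  constructor
  · intro hβZ
    have hB0 : 0 < B := IsCyclicCubic.trace_sq_pos hψ (fun h => hβZ 0 (by simp [h])) hB
    have hpB := hs.two_mul_le_three_mul_trace_sq hψ hp hβZ hB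
    obtain ⟨m, rfl⟩ : (t : ℤ) ^ 2 ∣ B := natCast_dvd_of_squarefree_dvd htsq fun q hq hqt => by
      obtain ⟨-, I, hI⟩ := hram q hq (hqt.trans htp)
      exact hI.sq_dvd_trace_sq hs hq (hqβ q hq hqt) hB
    have hm : 0 < m := pos_of_mul_pos_right hB0 ht0'.le
    have hdm : (d : ℤ) * m < 11 := by
      refine lt_of_mul_lt_mul_left ?_ ht0'.le
      linarith
    have hd11 : d < 11 := by
      have : (d : ℤ) < 11 := by nlinarith
      exact_mod_cast this
    have htd' : t ≤ d := Nat.le_of_dvd (by omega) htd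
    refine ⟨?_, by omega⟩
    interval_cases d <;> first | omega | (interval_cases t <;> omega)
  · rintro b rfl hb hγ
    have hBb : B = 3 * b ^ 2 := by
      have : (B : A) = 3 * b ^ 2 := by
        rw [hB]; simp only [cyclicTrace, map_pow, map_intCast]; ring
      exact_mod_cast this
    have htb : (t : ℤ) ^ 1 ∣ b := natCast_dvd_of_squarefree_dvd htsq fun q hq hqt => by
      obtain ⟨-, I, hI⟩ := hram q hq (hqt.trans htp)
      rw [pow_one]
      refine (Nat.prime_iff_prime_int.mp hq).dvd_of_dvd_pow (n := 2) (hI.dvd _ ?_)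
      push_cast
      exact I.mem_of_dvd (hqβ q hq hqt) hI.self_mem
    rw [pow_one] at htb
    obtain ⟨c, rfl⟩ := htb
    have hc : 0 < c ^ 2 := by
      have : c ≠ 0 := right_ne_zero_of_mul hb
      positivity
    have hdc : (d : ℤ) * (3 * c ^ 2) < 11 := by
      refine lt_of_mul_lt_mul_left ?_ ht0'.le
      rw [hBb] at hlt
      linarith
    have hd4' : d < 4 := by
      have : (d : ℤ) < 4 := by nlinarith
      exact_mod_cast this
    have hpG := hs.two_mul_le_three_mul_trace_sq hψ hp hγ hG
    have hB0 : 0 ≤ B := by rw [hBb]; positivity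
    have htd' : t ≤ d := Nat.le_of_dvd (by omega) htd
    have hdB : 0 ≤ (d : ℤ) * B := by positivity
    have ht1 : t = 1 := by
      interval_cases d <;> omega
    subst ht1
    constructor <;> omega

end Bounds

/-! ### The cyclic cubic field -/

section CubicField

variable {K : Type*} [Field K] [NumberField K] [IsGalois ℚ K] (hK : Module.finrank ℚ K = 3)
include hK

theorem isCyclicCubic_of_ne_one {s : Gal(K/ℚ)} (hs : s ≠ 1) :
    IsCyclicCubic (RingOfIntegers.mapRingHom (s : K →+* K)) where
  cube x := by
    have hG : Nat.card Gal(K/ℚ) = 3 := by rw [IsGalois.card_aut_eq_finrank, hK]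
    have h3 : s ^ 3 = 1 := hG ▸ pow_card_eq_one'
    apply RingOfIntegers.ext
    exact congrArg (fun g : Gal(K/ℚ) => g (x : K)) h3
  fixed x hx := by
    have hG : Nat.card Gal(K/ℚ) = 3 := by rw [IsGalois.card_aut_eq_finrank, hK]
    have := Fact.mk Nat.prime_three
    have hsx : s (x : K) = x := congrArg (algebraMap (𝓞 K) K) hx
    have hbot : (x : K) ∈ (⊥ : IntermediateField ℚ K) := by
      rw [IsGalois.mem_bot_iff_fixed]
      intro g
      have hg : Subgroup.zpowers s ≤ MulAction.stabilizer Gal(K/ℚ) (x : K) := by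
        rw [Subgroup.zpowers_le]; exact hsx
      exact hg (mem_zpowers_of_prime_card hG hs)
    obtain ⟨r, hr⟩ := IntermediateField.mem_bot.mp hbot
    have hint : IsIntegral ℤ r :=
      (isIntegral_algebraMap_iff (algebraMap ℚ K).injective).mp (hr ▸ x.2)
    obtain ⟨n, rfl⟩ := IsIntegrallyClosed.isIntegral_iff.mp hint
    exact ⟨n, RingOfIntegers.ext (by rw [← hr]; simp)⟩

/-- The prime powers dividing `p` are at most `9` for `q = 3` and `q` otherwise, exactly what the
inertial ideals supply. -/
theorem IsConductor.dvd_cyclicForm {p : ℕ} (hp : IsConductor K p) {s : Gal(K/ℚ)} (hs : s ≠ 1)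
    (x : 𝓞 K) (n : ℤ) (hn : (n : 𝓞 K) = cyclicForm (RingOfIntegers.mapRingHom (s : K →+* K)) x) :
    (p : ℤ) ∣ n := by
  have hc := isCyclicCubic_of_ne_one hK hs
  rw [Int.natCast_dvd, Nat.dvd_iff_prime_pow_dvd_dvd]
  intro q k hq hk
  rw [← Int.natCast_dvd]
  obtain rfl | hk0 := k.eq_zero_or_pos
  · simp
  obtain ⟨hqp, I, hI⟩ := hp.exists_inertialIdeal hK hq ((dvd_pow_self q hk0.ne').trans hk) s
  by_cases h3 : q = 3
  · have hk2 : k ≤ 2 := by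
      by_contra! h
      exact hqp.three h3 (by subst h3; exact (pow_dvd_pow 3 h).trans hk)
    have h9 := hI.nine_dvd_form hc h3 hn
    subst h3
    exact (Int.natCast_dvd_natCast.mpr (pow_dvd_pow 3 hk2)).trans (by exact_mod_cast h9)
  · have hk1 : k = 1 := by
      by_contra h
      exact (hqp.ne_three h3).2 ((pow_dvd_pow q (by omega)).trans hk)
    subst hk1
    simpa using hI.dvd_form hn

end CubicField

/-! ### The sextic field and its real subfield -/

theorem Complex.re_eq_zero_of_sq {w : ℂ} {d : ℕ} (hw : w ^ 2 = -(d : ℂ)) :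
    w.re = 0 ∧ w.im ^ 2 = d := by
  have h1 := congrArg Complex.re hw
  have h2 := congrArg Complex.im hw
  simp [pow_two] at h1 h2
  have hd : (0 : ℝ) ≤ d := d.cast_nonneg
  have h3 : w.re * w.im = 0 := by linarith
  rcases mul_eq_zero.mp h3 with h | h
  · rw [h] at h1
    exact ⟨h, by nlinarith⟩
  · rw [h] at h1
    have h0 : w.re = 0 := by nlinarith
    refine ⟨h0, ?_⟩
    rw [h0] at h1
    rw [h]
    linarith

theorem Complex.norm_sq_add_mul_div {w : ℂ} {d : ℕ} (hw : w ^ 2 = -(d : ℂ)) (x y : ℝ) (t : ℕ) :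
    ‖((x : ℂ) + y * w) / t‖ ^ 2 = (x ^ 2 + d * y ^ 2) / t ^ 2 := by
  obtain ⟨h1, h2⟩ := Complex.re_eq_zero_of_sq hw
  rw [norm_div, div_pow, Complex.norm_natCast, ← Complex.normSq_eq_norm_sq, Complex.normSq_apply]
  congr 1
  simp [h1]
  linear_combination y ^ 2 * h2

section CyclicSextic

variable {F : Type*} [Field F] [NumberField F] [IsGalois ℚ F] [IsTotallyComplex F]
  {τ : Gal(F/ℚ)} (hτ : ∀ g : Gal(F/ℚ), g ∈ Subgroup.zpowers τ)
include hτ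

omit [IsTotallyComplex F] in
theorem isAbelianGalois_of_zpowers : IsAbelianGalois ℚ F :=
  have : IsCyclic Gal(F/ℚ) := ⟨τ, hτ⟩
  IsAbelianGalois.of_isCyclic ℚ F

omit [IsTotallyComplex F] in
theorem isGalois_maximalRealSubfield : IsGalois ℚ (maximalRealSubfield F) :=
  have := isAbelianGalois_of_zpowers hτ
  (IsAbelianGalois.tower_bot ℚ (maximalRealSubfield F) F).toIsGalois

theorem finrank_maximalRealSubfield (hdeg : Module.finrank ℚ F = 6) :
    Module.finrank ℚ (maximalRealSubfield F) = 3 := by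
  have := isAbelianGalois_of_zpowers hτ
  have h := Module.finrank_mul_finrank ℚ (maximalRealSubfield F) F
  rw [Algebra.IsQuadraticExtension.finrank_eq_two (maximalRealSubfield F) F, hdeg] at h
  omega

theorem exists_restrict_maximalRealSubfield (hdeg : Module.finrank ℚ F = 6) :
    ∃ s : Gal(maximalRealSubfield F/ℚ), s ≠ 1 ∧
      ∀ x : maximalRealSubfield F, ((s x : maximalRealSubfield F) : F) = τ x := by
  have := isGalois_maximalRealSubfield hτ
  refine ⟨AlgEquiv.restrictNormalHom _ τ, fun h => ?_,
    fun x => AlgEquiv.restrictNormal_commutes τ _ x⟩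
  have hcard : Nat.card Gal(maximalRealSubfield F/ℚ) = 3 := by
    rw [IsGalois.card_aut_eq_finrank, finrank_maximalRealSubfield hτ hdeg]
  have hsub : Subsingleton Gal(maximalRealSubfield F/ℚ) := by
    refine subsingleton_of_forall_eq 1 fun g => ?_
    obtain ⟨g', rfl⟩ := AlgEquiv.restrictNormalHom_surjective (F := ℚ)
      (K₁ := maximalRealSubfield F) F g
    obtain ⟨i, rfl⟩ := hτ g'
    rw [map_zpow, h, one_zpow]
  rw [Nat.card_of_subsingleton 1] at hcard
  omega

/-- If `(γ + β √-d) / t` is an integer of a CM field with `γ`, `β` real and `t ∣ d`, then `t`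
divides `4 (d / t) β²`. -/
theorem natCast_dvd_four_mul_div_mul_sq (ι : F →+* ℂ) {d t : ℕ} {δ : F} (hδ : δ ^ 2 = -(d : F))
    (ht0 : t ≠ 0) (htd : t ∣ d) {γ β : 𝓞 (maximalRealSubfield F)}
    (hint : IsIntegral ℤ
      (((γ : maximalRealSubfield F) + (β : maximalRealSubfield F) * δ) / (t : F))) :
    (t : 𝓞 (maximalRealSubfield F)) ∣ 4 * (d / t : ℕ) * β ^ 2 := by
  have := isAbelianGalois_of_zpowers hτ
  let c := IsCMField.complexConj F
  have hcδ : c δ = -δ := by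
    apply ι.injective
    rw [(IsCMField.isConj_complexConj F ι).eq, map_neg]
    have hw : (ι δ) ^ 2 = -(d : ℂ) := by rw [← map_pow, hδ, map_neg, map_natCast]
    apply Complex.ext <;> simp [(Complex.re_eq_zero_of_sq hw).1]
  let K := maximalRealSubfield F
  have hcK : ∀ x : K, c (x : F) = x := fun x => c.commutes x
  set g : F := ((γ : K) : F) with hg
  set b : F := ((β : K) : F) with hb
  have hint' : IsIntegral ℤ (c ((g + b * δ) / (t : F))) := 
    map_isIntegral_int (c : F →+* F) hint
  have hc : c ((g + b * δ) / (t : F)) = (g - b * δ) / t := by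
    rw [map_div₀, map_add, map_mul, hcK, hcK, hcδ, map_natCast]; ring
  rw [hc] at hint'
  have ht : (t : F) ≠ 0 := by exact_mod_cast ht0
  obtain ⟨e, rfl⟩ := htd
  rw [Nat.mul_div_cancel_left _ (Nat.pos_of_ne_zero ht0)]
  have hy : IsIntegral ℤ (4 * (e : F) * b ^ 2 / t) := by
    have h4 : IsIntegral ℤ (4 : F) := by simpa using isIntegral_algebraMap (R := ℤ) (A := F) (x := 4)
    have h :=
      (h4.mul (hint.mul hint')).sub ((hint.add hint').pow 2)
    -- Minus the discriminant of `f`: four times its relative norm minus the square of its relative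
    -- trace.
    have heq : 4 * (e : F) * b ^ 2 / t = 4 * ((g + b * δ) / t * ((g - b * δ) / t)) -
        ((g + b * δ) / t + (g - b * δ) / t) ^ 2 := by
      push_cast at hδ
      field_simp
      linear_combination (4 * b ^ 2) * hδ
    rw [heq]
    exact h
  have hyK : IsIntegral ℤ (4 * (e : K) * (β : K) ^ 2 / t) := by
    rw [← isIntegral_algebraMap_iff (algebraMap K F).injective]
    convert hy using 1
    simp [hb]
    rfl
  refine ⟨⟨_, hyK⟩, RingOfIntegers.ext ?_⟩
  have htK : (t : K) ≠ 0 := by exact_mod_cast ht0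
  change algebraMap (𝓞 K) K (4 * (e : 𝓞 K) * β ^ 2) =
    algebraMap (𝓞 K) K (t : 𝓞 K) * (4 * (e : K) * (β : K) ^ 2 / t)
  simp only [map_mul, map_pow, map_natCast, map_ofNat]
  rw [mul_div_cancel₀ _ htK]

end CyclicSextic

/-! ### The proposition -/

theorem proposition3p2
    -- `F` is an imaginary cyclic sextic field, embedded in `ℂ` through `ι`,
    -- and `τ` generates its Galois group
    (F : Type*) [Field F] [NumberField F] [IsGalois ℚ F] [IsTotallyComplex F]
    (hdeg : Module.finrank ℚ F = 6) (ι : F →+* ℂ)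
    (τ : Gal(F/ℚ)) (hτ : ∀ g : Gal(F/ℚ), g ∈ Subgroup.zpowers τ)
    -- `K` is the maximal real subfield of `F`, `p` its conductor
    (K : Subfield F) (hK : K = maximalRealSubfield F) (p : ℕ) (hp : IsConductor K p)
    -- `k = ℚ(√-d)` is the imaginary quadratic subfield of `F`, and `δ = √-d`
    (d : ℕ) (hd : Squarefree d) (hd4 : d % 4 = 1 ∨ d % 4 = 2)
    (δ : F) (hδ : δ ^ 2 = -(d : F))
    (k : Subfield F) (hk : k = (IntermediateField.adjoin ℚ {δ}).toSubfield)
    (t : ℕ) (ht : t = Nat.gcd p d)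
    (f γ β : F)
    (hf : f ∈ (integersOf (⊤ : Subfield F) : Set F) \
      ((integersOf K : Set F) ∪ (integersOf k : Set F) ∪ rootsOfUnitySet F))
    (hγ : γ ∈ integersOf K) (hβ : β ∈ integersOf K)
    (hfγβ : f = (γ + β * δ) / (t : F))
    (hlen : lengthSq ι τ f < 22) :
    (β ∉ Set.range ((↑) : ℤ → F) → p ≤ 19 ∧ d ≤ 22) ∧
    (β ∈ Set.range ((↑) : ℤ → F) → β ≠ 0 → p ≤ 61 ∧ d ≤ 14) := by
  subst hK
  set K := maximalRealSubfield F with hKdef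
  have := isGalois_maximalRealSubfield hτ
  have hK3 := finrank_maximalRealSubfield hτ hdeg
  obtain ⟨s, hs1, hs⟩ := exists_restrict_maximalRealSubfield hτ hdeg
  have hc := isCyclicCubic_of_ne_one hK3 hs1
  have hd0 : d ≠ 0 := hd.ne_zero
  have htd : t ∣ d := ht ▸ Nat.gcd_dvd_right p d
  have ht0 : t ≠ 0 := fun h => hd0 (Nat.eq_zero_of_zero_dvd (h ▸ htd))
  obtain ⟨γ', rfl⟩ : ∃ x : 𝓞 K, ((x : K) : F) = γ :=
    ⟨⟨⟨γ, hγ.2⟩, (isIntegral_algebraMap_iff (algebraMap K F).injective).mp hγ.1⟩, rfl⟩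
  obtain ⟨β', rfl⟩ : ∃ x : 𝓞 K, ((x : K) : F) = β :=
    ⟨⟨⟨β, hβ.2⟩, (isIntegral_algebraMap_iff (algebraMap K F).injective).mp hβ.1⟩, rfl⟩
  have hreal : ComplexEmbedding.IsReal (ι.comp (algebraMap K F)) := by
    ext x
    exact x.2 ι
  let ψ : 𝓞 K →+* ℝ := hreal.embedding.comp (algebraMap (𝓞 K) K)
  have hψ : Function.Injective ψ :=
    hreal.embedding.injective.comp (FaithfulSMul.algebraMap_injective (𝓞 K) K)
  have hψι : ∀ x : 𝓞 K, ((ψ x : ℝ) : ℂ) = ι (x : K) := fun x =>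
    hreal.coe_embedding_apply (x : K)
  have hdvd := natCast_dvd_four_mul_div_mul_sq hτ ι hδ ht0 htd (γ := γ') (β := β')
    (hfγβ ▸ hf.1.1)
  obtain ⟨G, hG⟩ := hc.exists_trace (γ' ^ 2)
  obtain ⟨B, hB⟩ := hc.exists_trace (β' ^ 2)
  have hterm : ∀ (g : Gal(F/ℚ)) (x y : 𝓞 K), g (γ' : K) = (x : K) → g (β' : K) = (y : K) →
      ‖ι (g f)‖ ^ 2 = (ψ x ^ 2 + d * ψ y ^ 2) / t ^ 2 := by
    intro g x y hx hy
    have hw : (ι (g δ)) ^ 2 = -(d : ℂ) := by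
      rw [← map_pow, ← map_pow, hδ, map_neg, map_neg, map_natCast, map_natCast]
    rw [← Complex.norm_sq_add_mul_div hw, hfγβ, hψι, hψι, ← hx, ← hy]
    simp only [map_div₀, map_add, map_mul, map_natCast]
  have hlt : G + d * B < 11 * (t : ℤ) ^ 2 := by
    set S := RingOfIntegers.mapRingHom (s : K →+* K) with hS
    have hS1 : ∀ x : 𝓞 K, ((S x : K) : F) = τ (x : K) := fun x => hs x
    have hG' := congrArg ψ hG
    have hB' := congrArg ψ hB
    simp only [cyclicTrace, map_intCast, map_add, map_pow] at hG' hB'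
    rw [lengthSq, Finset.sum_range_succ, Finset.sum_range_succ, Finset.sum_range_one,
      hterm (τ ^ 0) γ' β' rfl rfl, hterm (τ ^ 1) (S γ') (S β') (by rw [hS1, pow_one])
        (by rw [hS1, pow_one]), hterm (τ ^ 2) (S (S γ')) (S (S β'))
        (by rw [hS1, hS1]; rfl) (by rw [hS1, hS1]; rfl), ← add_div, ← add_div, ← mul_div_assoc,
      div_lt_iff₀ (by positivity)] at hlen
    have : (G : ℝ) + d * B < 11 * (t : ℝ) ^ 2 := by
      rw [hG', hB']; linarith
    exact_mod_cast this
  obtain ⟨h1, h2⟩ := conductor_discriminant_bounds hc hψ (hp.dvd_cyclicForm hK3 hs1)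
    (fun q hq hqp => hp.exists_inertialIdeal hK3 hq hqp s) hd hd4 ht hdvd hG hB hlt
  have hint : ∀ (n : ℤ) (x : 𝓞 K), (n : 𝓞 K) = x ↔ (n : F) = (x : K) := fun n x => by
    constructor
    · rintro rfl
      simp
    · intro h
      apply RingOfIntegers.ext
      apply Subtype.ext
      simpa using h
  refine ⟨fun hβZ => h1 fun b hb => hβZ ⟨b, (hint b β').mp hb⟩, ?_⟩
  rintro ⟨b, hb⟩ hβ0
  -- If `γ` were an integer as well, `f` would lie in `O_k`, which is excluded.
  refine h2 b ((hint b β').mpr hb) ?_ fun m hm => hf.2 (Or.inl (Or.inr ⟨hf.1.1, ?_⟩))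
  · rintro rfl
    exact hβ0 (by rw [← hb, Int.cast_zero])
  · rw [hk, hfγβ, ← hb, ← (hint m γ').mp hm]
    have hδk : δ ∈ IntermediateField.adjoin ℚ {δ} := IntermediateField.mem_adjoin_simple_self ℚ δ
    exact div_mem (H := IntermediateField.adjoin ℚ {δ})
      (add_mem (intCast_mem _ m) (mul_mem (intCast_mem _ b) hδk)) (natCast_mem _ t)
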